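/- Consider a Pandora's Box instance with $n$ boxes: box $i$ has an opening cost $c_i\in\mathbb{R}$ and a real value $v_i\sim\mathcal{D}_i$, the values being independent. If the set of opened boxes is $\mathcal{P}$, the cost is $\min_{i\in\mathcal{P}}v_i+\sum_{i\in\mathcal{P}}c_i$. Weitzman's algorithm, run with reservation values $\boldsymbol\sigma\in\mathbb{R}^n$, sorts the boxes as $\pi_1,\dots,\pi_n$ by increasing $\sigma_i$ (ties broken arbitrarily) and opens them in this order, stopping after box $\pi_k$ as soon as $k=n$ or $\min_{j\le k}v_{\pi_j}<\sigma_{\pi_{k+1}}$. Let $\mathrm{WEITZ}_{\boldsymbol{\mathcal D}}(\boldsymbol\sigma;\boldsymbol c)\in(-\infty,+\infty]$ be its expected cost. For a distribution $\mathcal{D}$ on $\mathbb{R}$ let $c_{\mathcal D}(\sigma)=\mathbb{E}_{v\sim\mathcal D}[\mathrm{ReLU}(\sigma-v)]$, where $\mathrm{ReLU}(x)=\max\{x,0\}$, and let $\boldsymbol c_{\boldsymbol{\mathcal D}}(\boldsymbol\sigma)=(c_{\mathcal D_1}(\sigma_1),\dots,c_{\mathcal D_n}(\sigma_n))$ (the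 approximate costs). Let $\boldsymbol\sigma^*\in\mathbb{R}^n$ be the optimal reservation values of the instance, that is, $c_{\mathcal D_i}(\sigma_i^*)$ is finite and equal to $c_i$ for every $i$. Then for every $\boldsymbol\sigma\in\mathbb{R}^n$, $$\mathrm{WEITZ}_{\boldsymbol{\mathcal D}}(\boldsymbol\sigma;\boldsymbol c)\;\le\;\mathrm{WEITZ}_{\boldsymbol{\mathcal D}}(\boldsymbol\sigma^*;\boldsymbol c)+\|\boldsymbol c_{\boldsymbol{\mathcal D}}(\boldsymbol\sigma)-\boldsymbol c\|_1,$$ however ties are broken in the two runs. -/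

import Mathlib

open MeasureTheory

noncomputable section

namespace PandorasBox

/-- The rectifier `ReLU(x) = max {x, 0}`. -/
def relu (x : ℝ) : ℝ := max x 0

/-- The approximate cost `c_D(σ) = E_{v ∼ D}[ReLU(σ - v)]`. -/
def approxCost (D : Measure ℝ) (σ : ℝ) : ℝ := ∫ v, relu (σ - v) ∂D

/-- The for-loop of Weitzman's algorithm with reservation values `σ` on the realized values `v`.
The arguments are the current value of `v_min` and the list of the boxes that are still to be
visited, in the order in which they are visited; the result is the list of the boxes opened from
this point on. The next box is opened, `v_min` is updated, and the loop stops as soon as `v_min`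
is smaller than the reservation value of the box that comes next (or no box is left). -/
def weitzmanLoop {n : ℕ} (σ v : Fin n → ℝ) : EReal → List (Fin n) → List (Fin n)
  | _, [] => []
  | _, [i] => [i]
  | vmin, i :: j :: rest =>
      if min vmin (v i : EReal) < (σ j : EReal) then [i]
      else i :: weitzmanLoop σ v (min vmin (v i : EReal)) (j :: rest)

/-- `π` (position `k` holds box `π k`) sorts the boxes by increasing reservation value.
Ties may be broken in any way. -/
def IsSortedOrder {n : ℕ} (σ : Fin n → ℝ) (π : Equiv.Perm (Fin n)) : Prop :=
  Monotone fun k => σ (π k)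

/-- The set of boxes opened by Weitzman's algorithm, run with reservation values `σ`, in the
order `π 0, π 1, …`, on the realized values `v`; initially `v_min = ∞`. -/
def weitzmanOpened {n : ℕ} (σ : Fin n → ℝ) (π : Equiv.Perm (Fin n)) (v : Fin n → ℝ) :
    Finset (Fin n) :=
  (weitzmanLoop σ v ⊤ (List.ofFn π)).toFinset

/-- The cost `min_{i ∈ P} v_i + ∑_{i ∈ P} c_i` of opening exactly the boxes in `P` when the
values are `v` (the minimum over the empty set is `∞`). -/
def pandoraCost {n : ℕ} (c v : Fin n → ℝ) (P : Finset (Fin n)) : EReal :=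
  (P.inf fun i => (v i : EReal)) + ((∑ i ∈ P, c i : ℝ) : EReal)

/-- The expectation `E[f⁺] - E[f⁻]` of an extended-real random variable. It may be infinite, and
is meaningful whenever `E[f⁺]` and `E[f⁻]` are not both infinite. -/
def expectation {Ω : Type*} [MeasurableSpace Ω] (μ : Measure Ω) (f : Ω → EReal) : EReal :=
  ((∫⁻ ω, (f ω).toENNReal ∂μ : ENNReal) : EReal) -
    ((∫⁻ ω, (-f ω).toENNReal ∂μ : ENNReal) : EReal)

/-- `WEITZ_D(σ; c)`: the expected cost of Weitzman's algorithm run with reservation values `σ`,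
visiting the boxes in the order `π`, on the instance with independent values `v_i ∼ D i` and
opening costs `c`. -/
def weitz {n : ℕ} (D : Fin n → Measure ℝ) (σ : Fin n → ℝ) (π : Equiv.Perm (Fin n))
    (c : Fin n → ℝ) : EReal :=
  expectation (Measure.pi D) fun v => pandoraCost c v (weitzmanOpened σ π v)

end PandorasBox

end

open MeasureTheory

namespace PandorasBox

/-! ### The boxes opened by Weitzman's algorithm -/

/-! Amortization: charge an opened box `j` the amount `relu (σ j - v j)` instead of `c j`. For each
realization, the amortized cost of the run with `σ` is at most `min_q max (v q) (σ q)`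
(`add_sum_relu_weitzmanOpened_le`), while that of any nonempty set is at least this
(`max_le_add_sum_relu`). Comparing with the set opened by the `σopt` run on the same values leaves
only the differences `c j - relu (σ j - v j)`, summed over the two opened sets.

Whether `j` is opened depends only on boxes before it, hence is independent of `v j`. In expectation
each difference becomes `c j - approxCost (D j) (σ j)` times a difference of two probabilities, at
most its absolute value. If the `σopt` cost is not integrable, its expectation is `⊤`. -/

theorem getElem_mem_weitzmanLoop_iff {n : ℕ} (σ v : Fin n → ℝ) (l : List (Fin n))
    (hs : l.Pairwise fun i j => σ i ≤ σ j) (hn : l.Nodup) (m : EReal) (k : ℕ)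
    (hk : k < l.length) :
    l[k] ∈ weitzmanLoop σ v m l ↔
      k = 0 ∨ ((σ l[k] : EReal) ≤ m ∧ ∀ j (hj : j < k), σ l[k] ≤ v l[j]) := by
  induction l generalizing m k with
  | nil => simp at hk
  | cons i l ih =>
    cases l with
    | nil =>
      obtain rfl : k = 0 := by simpa using hk
      simp [weitzmanLoop]
    | cons j rest =>
      cases k with
      | zero => by_cases h : min m (v i : EReal) < (σ j : EReal) <;> simp [weitzmanLoop, h]
      | succ k =>
        have hk' : k < (j :: rest).length := by simpa using hk
        have hne : (j :: rest)[k] ≠ i := fun h =>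
          (List.nodup_cons.1 hn).1 (h ▸ List.getElem_mem hk')
        have hj : σ j ≤ σ (j :: rest)[k] := by
          cases k with
          | zero => exact le_rfl
          | succ k =>
            exact (List.pairwise_cons.1 (List.pairwise_cons.1 hs).2).1 _ (List.getElem_mem _)
        have hall : (∀ t (ht : t < k + 1), σ (j :: rest)[k] ≤ v (i :: j :: rest)[t]) ↔
            σ (j :: rest)[k] ≤ v i ∧ ∀ t (ht : t < k), σ (j :: rest)[k] ≤ v (j :: rest)[t] := by
          refine ⟨fun h => ⟨h 0 (by omega), fun t ht => h (t + 1) (by omega)⟩, ?_⟩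
          rintro ⟨h0, h⟩ (_ | t) ht
          · exact h0
          · exact h t (by omega)
        simp only [List.getElem_cons_succ, Nat.succ_ne_zero, false_or, hall]
        by_cases h : min m (v i : EReal) < (σ j : EReal)
        -- The loop stops here. By sortedness all later thresholds are at least `σ j`, so the right
        -- side fails too.
        · simp only [weitzmanLoop, h, if_true, List.mem_singleton, hne, false_iff]
          rintro ⟨h1, h2, -⟩
          have h3 : (σ (j :: rest)[k] : EReal) ≤ min m (v i : EReal) :=
            le_min h1 (EReal.coe_le_coe_iff.2 h2)
          exact absurd (h3.trans_lt h) (not_lt.2 (EReal.coe_le_coe_iff.2 hj))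
        · simp only [weitzmanLoop, h, if_false]
          rw [List.mem_cons, or_iff_right hne]
          have := ih (List.pairwise_cons.1 hs).2 (List.nodup_cons.1 hn).2
            (min m (v i : EReal)) k hk'
          rw [this, le_min_iff, EReal.coe_le_coe_iff, and_assoc]
          refine ⟨?_, Or.inr⟩
          -- The next box is opened unconditionally; the failed stopping test supplies its bounds.
          rintro (rfl | h')
          · obtain ⟨h1, h2⟩ := le_min_iff.1 (not_lt.1 h)
            exact ⟨h1, EReal.coe_le_coe_iff.1 h2, by simp⟩
          · exact h'

theorem apply_mem_weitzmanOpened_iff {n : ℕ} {σ : Fin n → ℝ} {π : Equiv.Perm (Fin n)}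
    (hπ : IsSortedOrder σ π) (v : Fin n → ℝ) (k : Fin n) :
    π k ∈ weitzmanOpened σ π v ↔ ∀ j < k, σ (π k) ≤ v (π j) := by
  have hs : (List.ofFn π).Pairwise fun i j => σ i ≤ σ j :=
    List.pairwise_ofFn.2 fun _ _ h => hπ h.le
  have := getElem_mem_weitzmanLoop_iff σ v _ hs (List.nodup_ofFn.2 π.injective) ⊤ k (by simp)
  simp only [List.getElem_ofFn, le_top, true_and] at this
  rw [weitzmanOpened, List.mem_toFinset]
  refine this.trans ⟨?_, fun h => Or.inr fun j hj => h ⟨j, by omega⟩ hj⟩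
  rintro (h | h) j hj
  · exact absurd (Fin.lt_def.1 hj) (by omega)
  · exact h j hj

theorem mem_weitzmanOpened_iff {n : ℕ} {σ : Fin n → ℝ} {π : Equiv.Perm (Fin n)}
    (hπ : IsSortedOrder σ π) (v : Fin n → ℝ) (i : Fin n) :
    i ∈ weitzmanOpened σ π v ↔ ∀ j, π.symm j < π.symm i → σ i ≤ v j := by
  have := apply_mem_weitzmanOpened_iff hπ v (π.symm i)
  rw [Equiv.apply_symm_apply] at this
  rw [this]
  exact ⟨fun h j hj => by simpa using h _ hj, fun h j hj => h _ (by simpa using hj)⟩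

theorem weitzmanOpened_nonempty {n : ℕ} [NeZero n] {σ : Fin n → ℝ} {π : Equiv.Perm (Fin n)}
    (hπ : IsSortedOrder σ π) (v : Fin n → ℝ) : (weitzmanOpened σ π v).Nonempty :=
  ⟨π 0, (apply_mem_weitzmanOpened_iff hπ v 0).2 fun j hj => absurd hj (Fin.not_lt_zero j)⟩

/-! ### The pointwise amortization inequality -/

theorem relu_nonneg (x : ℝ) : 0 ≤ relu x := le_max_right _ _

/-- The earliest box before `q` with value below `σ q` works: all boxes before it have values at
least `σ q`, which is at least its own threshold, so it is opened. -/
theorem exists_mem_le_of_lt {n : ℕ} {σ : Fin n → ℝ} {π : Equiv.Perm (Fin n)}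
    (hπ : IsSortedOrder σ π) (v : Fin n → ℝ) (q : Fin n) (hq : q ∉ weitzmanOpened σ π v) :
    ∃ p ∈ weitzmanOpened σ π v, v p < σ q := by
  obtain ⟨k, rfl⟩ := π.surjective q
  have hex : ∃ j, j < k ∧ v (π j) < σ (π k) := by
    simpa [apply_mem_weitzmanOpened_iff hπ] using hq
  obtain ⟨j, ⟨hjk, hj⟩, hmin⟩ := WellFounded.has_min wellFounded_lt
    {j | j < k ∧ v (π j) < σ (π k)} hex
  refine ⟨π j, (apply_mem_weitzmanOpened_iff hπ v j).2 fun t ht => ?_, hj⟩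
  by_contra! h
  exact hmin t ⟨ht.trans hjk, h.trans_le (hπ hjk.le)⟩ ht

/-- The amortized cost of Weitzman's algorithm is at most `min_q max {v_q, σ_q}`. -/
theorem add_sum_relu_weitzmanOpened_le {n : ℕ} {σ : Fin n → ℝ} {π : Equiv.Perm (Fin n)}
    (hπ : IsSortedOrder σ π) (v : Fin n → ℝ) {m : ℝ}
    (hm : ∀ j ∈ weitzmanOpened σ π v, m ≤ v j) (q : Fin n) :
    m + ∑ j ∈ weitzmanOpened σ π v, relu (σ j - v j) ≤ max (v q) (σ q) := by
  by_cases h : ∃ p ∈ weitzmanOpened σ π v, v p < σ p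
  · obtain ⟨p, hp, hlt⟩ := h
    -- Only `p` is charged: boxes before `p` have values at least `σ p`, and a later box `b` is
    -- opened only if `σ b ≤ v p < σ p`, against sortedness.
    have hsum : ∑ j ∈ weitzmanOpened σ π v, relu (σ j - v j) = relu (σ p - v p) := by
      refine Finset.sum_eq_single_of_mem p hp fun b hb hbp => max_eq_right ?_
      have hb' := (mem_weitzmanOpened_iff hπ v b).1 hb
      have hp' := (mem_weitzmanOpened_iff hπ v p).1 hp
      rcases lt_trichotomy (π.symm b) (π.symm p) with hl | he | hl
      · have h1 := hp' b hl
        have h2 := hπ hl.le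
        simp only [Equiv.apply_symm_apply] at h2
        linarith
      · exact absurd (π.symm.injective he) hbp
      · have h1 := hb' p hl
        have h2 := hπ hl.le
        simp only [Equiv.apply_symm_apply] at h2
        linarith
    rw [hsum, relu, max_eq_left (by linarith)]
    have hq : σ p ≤ max (v q) (σ q) := by
      rcases lt_or_ge (π.symm q) (π.symm p) with hl | hl
      · exact le_max_of_le_left ((mem_weitzmanOpened_iff hπ v p).1 hp q hl)
      · have h2 := hπ hl
        simp only [Equiv.apply_symm_apply] at h2
        exact le_max_of_le_right h2
    linarith [hm p hp]
  · push Not at h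
    rw [Finset.sum_eq_zero fun j hj =>
      show relu (σ j - v j) = 0 from max_eq_right (sub_nonpos.2 (h j hj)), add_zero]
    by_cases hq : q ∈ weitzmanOpened σ π v
    · exact le_max_of_le_left (hm q hq)
    · obtain ⟨p, hp, hlt⟩ := exists_mem_le_of_lt hπ v q hq
      exact le_max_of_le_right ((hm p hp).trans hlt.le)

theorem max_le_add_sum_relu {n : ℕ} (σ v : Fin n → ℝ) {Q : Finset (Fin n)} {q : Fin n}
    (hq : q ∈ Q) : max (v q) (σ q) ≤ v q + ∑ j ∈ Q, relu (σ j - v j) := by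
  have h1 : relu (σ q - v q) ≤ ∑ j ∈ Q, relu (σ j - v j) :=
    Finset.single_le_sum (f := fun j => relu (σ j - v j)) (fun _ _ => relu_nonneg _) hq
  have h2 : max (v q) (σ q) = v q + relu (σ q - v q) := by
    rw [relu, ← max_add_add_left, max_comm]
    simp
  linarith

theorem exists_mem_pandoraCost_eq {n : ℕ} (c v : Fin n → ℝ) {P : Finset (Fin n)}
    (hP : P.Nonempty) :
    ∃ i ∈ P, (∀ j ∈ P, v i ≤ v j) ∧ pandoraCost c v P = ((v i + ∑ j ∈ P, c j : ℝ) : EReal) := by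
  obtain ⟨i, hi, hmin⟩ := P.exists_min_image v hP
  refine ⟨i, hi, hmin, ?_⟩
  have : (P.inf fun i => (v i : EReal)) = (v i : EReal) :=
    le_antisymm (Finset.inf_le hi) (Finset.le_inf fun j hj => EReal.coe_le_coe_iff.2 (hmin j hj))
  rw [pandoraCost, this, EReal.coe_add]

theorem coe_toReal_pandoraCost {n : ℕ} (c v : Fin n → ℝ) {P : Finset (Fin n)}
    (hP : P.Nonempty) : ((pandoraCost c v P).toReal : EReal) = pandoraCost c v P := by
  obtain ⟨i, -, -, h⟩ := exists_mem_pandoraCost_eq c v hP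
  rw [h, EReal.toReal_coe]

/-- Pointwise comparison of Weitzman's algorithm with any other set of opened boxes: the costs
differ by at most the differences between the opening costs and their amortized counterparts. -/
theorem pandoraCost_weitzmanOpened_le {n : ℕ} [NeZero n] {σ : Fin n → ℝ}
    {π : Equiv.Perm (Fin n)} (hπ : IsSortedOrder σ π) (c v : Fin n → ℝ) {Q : Finset (Fin n)}
    (hQ : Q.Nonempty) :
    pandoraCost c v (weitzmanOpened σ π v) ≤
      (((pandoraCost c v Q).toReal +
        (∑ j ∈ weitzmanOpened σ π v, (c j - relu (σ j - v j)) -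
          ∑ j ∈ Q, (c j - relu (σ j - v j))) : ℝ) : EReal) := by
  obtain ⟨i, hi, hmin, h⟩ := exists_mem_pandoraCost_eq c v (weitzmanOpened_nonempty hπ v)
  obtain ⟨q, hq, -, h'⟩ := exists_mem_pandoraCost_eq c v hQ
  rw [h, h', EReal.coe_le_coe_iff, EReal.toReal_coe, Finset.sum_sub_distrib,
    Finset.sum_sub_distrib]
  linarith [add_sum_relu_weitzmanOpened_le hπ v hmin q, max_le_add_sum_relu σ v hq]

/-! ### Extended expectations -/

theorem expectation_mono {Ω : Type*} [MeasurableSpace Ω] (μ : Measure Ω) {f g : Ω → EReal}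
    (h : ∀ ω, f ω ≤ g ω) : expectation μ f ≤ expectation μ g := by
  refine EReal.sub_le_sub ?_ ?_
  · exact EReal.coe_ennreal_le_coe_ennreal_iff.2
      (lintegral_mono fun ω => EReal.toENNReal_le_toENNReal (h ω))
  · exact EReal.coe_ennreal_le_coe_ennreal_iff.2
      (lintegral_mono fun ω => EReal.toENNReal_le_toENNReal (EReal.neg_le_neg_iff.2 (h ω)))

theorem expectation_coe {Ω : Type*} [MeasurableSpace Ω] (μ : Measure Ω) (g : Ω → ℝ) :
    expectation μ (fun ω => (g ω : EReal)) =
      ((∫⁻ ω, ENNReal.ofReal (g ω) ∂μ : ENNReal) : EReal) -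
        ((∫⁻ ω, ENNReal.ofReal (-g ω) ∂μ : ENNReal) : EReal) := by
  simp only [expectation, ← EReal.coe_neg, EReal.toENNReal_of_ne_top (EReal.coe_ne_top _),
    EReal.toReal_coe]

theorem expectation_coe_of_integrable {Ω : Type*} [MeasurableSpace Ω] {μ : Measure Ω}
    {g : Ω → ℝ} (hg : Integrable g μ) :
    expectation μ (fun ω => (g ω : EReal)) = ((∫ ω, g ω ∂μ : ℝ) : EReal) := by
  have h1 : ∫⁻ ω, ENNReal.ofReal (g ω) ∂μ ≠ ⊤ := hg.lintegral_lt_top.ne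
  have h2 : ∫⁻ ω, ENNReal.ofReal (-g ω) ∂μ ≠ ⊤ := hg.neg.lintegral_lt_top.ne
  rw [expectation_coe, integral_eq_lintegral_pos_part_sub_lintegral_neg_part hg, EReal.coe_sub,
    EReal.coe_ennreal_toReal h1, EReal.coe_ennreal_toReal h2]

/-- The integrable minorant `h` keeps the negative part finite, so the positive part must be
infinite. -/
theorem expectation_coe_of_not_integrable {Ω : Type*} [MeasurableSpace Ω] {μ : Measure Ω}
    {g h : Ω → ℝ} (hgm : AEStronglyMeasurable g μ) (hh : Integrable h μ) (hle : ∀ ω, h ω ≤ g ω)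
    (hg : ¬ Integrable g μ) : expectation μ (fun ω => (g ω : EReal)) = ⊤ := by
  have h2 : ∫⁻ ω, ENNReal.ofReal (-g ω) ∂μ < ⊤ :=
    (lintegral_mono fun ω => ENNReal.ofReal_le_ofReal (neg_le_neg (hle ω))).trans_lt
      hh.neg.lintegral_lt_top
  have h1 : ∫⁻ ω, ENNReal.ofReal (g ω) ∂μ = ⊤ := by
    by_contra h1
    refine hg ⟨hgm, ?_⟩
    rw [hasFiniteIntegral_iff_norm]
    have : ∀ ω, ENNReal.ofReal ‖g ω‖ ≤ ENNReal.ofReal (g ω) + ENNReal.ofReal (-g ω) := by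
      intro ω
      rcases le_total 0 (g ω) with h | h
      · rw [Real.norm_of_nonneg h]; exact le_self_add
      · rw [Real.norm_of_nonpos h]; exact le_add_self
    refine (lintegral_mono this).trans_lt ?_
    rw [lintegral_add_left' hgm.aemeasurable.ennreal_ofReal]
    exact ENNReal.add_lt_top.2 ⟨lt_top_iff_ne_top.2 h1, h2⟩
  rw [expectation_coe, h1, ← EReal.coe_ennreal_toReal h2.ne]
  exact EReal.top_sub_coe _

/-! ### Measurability and independence -/

theorem measurableSet_mem_weitzmanOpened {n : ℕ} {σ : Fin n → ℝ} {π : Equiv.Perm (Fin n)}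
    (hπ : IsSortedOrder σ π) (i : Fin n) :
    MeasurableSet {v : Fin n → ℝ | i ∈ weitzmanOpened σ π v} := by
  simp only [mem_weitzmanOpened_iff hπ, Set.ofPred_forall]
  exact MeasurableSet.iInter fun j => MeasurableSet.iInter fun _ =>
    measurableSet_le measurable_const (measurable_pi_apply j)

theorem measurable_pandoraCost {n : ℕ} (c : Fin n → ℝ) {P : (Fin n → ℝ) → Finset (Fin n)}
    (hP : ∀ i, MeasurableSet {v | i ∈ P v}) : Measurable fun v => pandoraCost c v (P v) := by
  classical
  -- There are finitely many possible opened sets, so measurability is checked for each fixed one.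
  let _ : MeasurableSpace (Finset (Fin n)) := ⊤
  have hPm : Measurable P := by
    refine measurable_to_countable' fun Q => ?_
    have : P ⁻¹' {Q} = ⋂ i, {v | i ∈ P v ↔ i ∈ Q} := by
      ext v
      simp [Finset.ext_iff]
    rw [this]
    refine MeasurableSet.iInter fun i => ?_
    by_cases h : i ∈ Q
    · simpa [h] using hP i
    · simp only [h, iff_false]
      exact (hP i).compl
  have hF : Measurable fun x : Finset (Fin n) × (Fin n → ℝ) => pandoraCost c x.2 x.1 := by
    refine measurable_from_prod_countable_right fun Q => ?_
    refine Measurable.add ?_ (measurable_const (a := ((∑ i ∈ Q, c i : ℝ) : EReal)))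
    have : (fun v : Fin n → ℝ => Q.inf fun i => (v i : EReal)) =
        fun v => ⨅ i ∈ Q, (v i : EReal) := by
      ext v
      rw [Finset.inf_eq_iInf]
    rw [this]
    exact Measurable.biInf (Q : Set (Fin n)) Q.countable_toSet fun i _ => (measurable_pi_apply i).coe_real_ereal
  exact hF.comp (hPm.prodMk measurable_id)

theorem integral_eval_mul_prod {ι : Type*} [Fintype ι] [DecidableEq ι] (D : ι → Measure ℝ)
    [∀ i, IsProbabilityMeasure (D i)] (i : ι) (f : ℝ → ℝ) (g : ι → ℝ → ℝ)
    (hg : g i = fun _ => 1) :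
    ∫ v, f (v i) * ∏ j, g j (v j) ∂Measure.pi D =
      (∫ x, f x ∂D i) * ∫ v, ∏ j, g j (v j) ∂Measure.pi D := by
  have h : ∀ v : ι → ℝ, f (v i) * ∏ j, g j (v j) = ∏ j, Function.update g i f j (v j) := by
    intro v
    rw [← Finset.mul_prod_erase _ _ (Finset.mem_univ i),
      ← Finset.mul_prod_erase Finset.univ (fun j => Function.update g i f j (v j))
        (Finset.mem_univ i), hg, Function.update_self, one_mul]
    congr 1
    exact Finset.prod_congr rfl fun j hj => by
      rw [Function.update_of_ne (Finset.ne_of_mem_erase hj)]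
  simp only [h]
  rw [integral_fintype_prod_eq_prod, integral_fintype_prod_eq_prod,
    ← Finset.mul_prod_erase _ _ (Finset.mem_univ i),
    ← Finset.mul_prod_erase Finset.univ (fun j => ∫ x, g j x ∂D j) (Finset.mem_univ i), hg,
    Function.update_self]
  simp only [integral_const, probReal_univ, smul_eq_mul, mul_one, one_mul]
  congr 1
  exact Finset.prod_congr rfl fun j hj => by
    rw [Function.update_of_ne (Finset.ne_of_mem_erase hj)]

/-- Whether a box is opened is independent of its value. -/
theorem setIntegral_mem_weitzmanOpened {n : ℕ} (D : Fin n → Measure ℝ)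
    [∀ i, IsProbabilityMeasure (D i)] {σ : Fin n → ℝ} {π : Equiv.Perm (Fin n)}
    (hπ : IsSortedOrder σ π) (i : Fin n) (f : ℝ → ℝ) :
    ∫ v in {v | i ∈ weitzmanOpened σ π v}, f (v i) ∂Measure.pi D =
      (∫ x, f x ∂D i) * (Measure.pi D).real {v | i ∈ weitzmanOpened σ π v} := by
  classical
  -- The indicator of opening `i` is a product of one-coordinate factors, and the factor at `i` is
  -- constantly `1`.
  set g : Fin n → ℝ → ℝ := fun j x => if π.symm j < π.symm i → σ i ≤ x then 1 else 0 with hgdef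
  have hg : g i = fun _ => 1 := by
    ext x
    simp [hgdef]
  have hA := measurableSet_mem_weitzmanOpened hπ i
  have hprod : ∀ v : Fin n → ℝ, ∏ j, g j (v j) =
      {v | i ∈ weitzmanOpened σ π v}.indicator 1 v := by
    intro v
    by_cases h : i ∈ weitzmanOpened σ π v
    · rw [Set.indicator_of_mem (show v ∈ {v | i ∈ weitzmanOpened σ π v} from h)]
      exact Finset.prod_eq_one fun j _ => if_pos ((mem_weitzmanOpened_iff hπ v i).1 h j)
    · rw [Set.indicator_of_notMem (show v ∉ {v | i ∈ weitzmanOpened σ π v} from h)]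
      rw [mem_weitzmanOpened_iff hπ, not_forall] at h
      obtain ⟨j, hj⟩ := h
      exact Finset.prod_eq_zero (Finset.mem_univ j) (if_neg hj)
  have key := integral_eval_mul_prod D i f g hg
  simp only [hprod] at key
  rw [integral_indicator_one hA] at key
  rw [← key, ← integral_indicator hA]
  refine integral_congr_ae (Filter.Eventually.of_forall fun v => ?_)
  by_cases h : v ∈ {v | i ∈ weitzmanOpened σ π v} <;> simp [h]

/-- `relu` is 1-Lipschitz, so moving the threshold costs at most `|t - s|`. -/
theorem integrable_relu_sub {D : Measure ℝ} [IsProbabilityMeasure D] {s : ℝ}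
    (h : Integrable (fun v => relu (s - v)) D) (t : ℝ) :
    Integrable (fun v => relu (t - v)) D := by
  refine (h.add (integrable_const |t - s|)).mono' ?_ (Filter.Eventually.of_forall fun v => ?_)
  · exact ((measurable_const.sub measurable_id).max measurable_const).aestronglyMeasurable
  · rw [Real.norm_of_nonneg (relu_nonneg _)]
    refine max_le ?_ (add_nonneg (relu_nonneg _) (abs_nonneg _))
    have h1 : s - v ≤ relu (s - v) := le_max_left _ _
    have h2 := le_abs_self (t - s)
    simp only [Pi.add_apply]
    linarith

section Amortization

variable {n : ℕ} (D : Fin n → Measure ℝ) [∀ i, IsProbabilityMeasure (D i)]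
  {τ : Fin n → ℝ} {π : Equiv.Perm (Fin n)}

theorem integrable_comp_eval {i : Fin n} {f : ℝ → ℝ} (hf : Integrable f (D i)) :
    Integrable (fun v : Fin n → ℝ => f (v i)) (Measure.pi D) :=
  (measurePreserving_eval D i).integrable_comp_of_integrable hf

theorem sum_weitzmanOpened_eq_sum_indicator (f : Fin n → ℝ → ℝ) (v : Fin n → ℝ) :
    ∑ j ∈ weitzmanOpened τ π v, f j (v j) =
      ∑ j, {v | j ∈ weitzmanOpened τ π v}.indicator (fun v => f j (v j)) v := by
  classical
  simp only [Set.indicator_apply, Set.mem_ofPred_eq, Finset.sum_ite_mem, Finset.univ_inter]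

theorem integrable_sum_weitzmanOpened (hπ : IsSortedOrder τ π) {f : Fin n → ℝ → ℝ}
    (hf : ∀ i, Integrable (f i) (D i)) :
    Integrable (fun v => ∑ j ∈ weitzmanOpened τ π v, f j (v j)) (Measure.pi D) := by
  simp only [sum_weitzmanOpened_eq_sum_indicator]
  exact integrable_finsetSum _ fun j _ =>
    (integrable_comp_eval D (hf j)).indicator (measurableSet_mem_weitzmanOpened hπ j)

theorem integral_sum_weitzmanOpened (hπ : IsSortedOrder τ π) {f : Fin n → ℝ → ℝ}
    (hf : ∀ i, Integrable (f i) (D i)) :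
    ∫ v, ∑ j ∈ weitzmanOpened τ π v, f j (v j) ∂Measure.pi D =
      ∑ j, (∫ x, f j x ∂D j) * (Measure.pi D).real {v | j ∈ weitzmanOpened τ π v} := by
  simp only [sum_weitzmanOpened_eq_sum_indicator]
  rw [integral_finsetSum _ fun j _ =>
    (integrable_comp_eval D (hf j)).indicator (measurableSet_mem_weitzmanOpened hπ j)]
  refine Finset.sum_congr rfl fun j _ => ?_
  rw [integral_indicator (measurableSet_mem_weitzmanOpened hπ j),
    setIntegral_mem_weitzmanOpened D hπ]

end Amortization

/-- A lower bound for the cost of opening a nonempty set of boxes. -/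
theorem neg_sum_le_toReal_pandoraCost {n : ℕ} (c s v : Fin n → ℝ) {P : Finset (Fin n)}
    (hP : P.Nonempty) :
    -∑ i, (|s i| + relu (s i - v i) + |c i|) ≤ (pandoraCost c v P).toReal := by
  obtain ⟨i, hi, -, h⟩ := exists_mem_pandoraCost_eq c v hP
  rw [h, EReal.toReal_coe, Finset.sum_add_distrib]
  have h1 : |s i| + relu (s i - v i) ≤ ∑ i, (|s i| + relu (s i - v i)) :=
    Finset.single_le_sum (f := fun i => |s i| + relu (s i - v i))
      (fun _ _ => add_nonneg (abs_nonneg _) (relu_nonneg _)) (Finset.mem_univ i)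
  have h2 : -∑ j ∈ P, c j ≤ ∑ j, |c j| := by
    refine (neg_le_abs _).trans ((Finset.abs_sum_le_sum_abs _ _).trans ?_)
    exact Finset.sum_le_sum_of_subset_of_nonneg (Finset.subset_univ _) fun _ _ _ => abs_nonneg _
  have h3 : s i - v i ≤ relu (s i - v i) := le_max_left _ _
  linarith [neg_abs_le (s i)]

end PandorasBox

open PandorasBox

/-- Robustness of Weitzman's algorithm. The integrability hypothesis says that the expectation
`E[ReLU(σ*_i - v_i)]`, required to equal the cost `c_i`, is finite; it keeps the negative part of
all expected costs below finite, while an expected cost `+∞` is allowed. -/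
theorem mainTheorem2 (n : ℕ) (D : Fin n → MeasureTheory.Measure ℝ)
    [∀ i, MeasureTheory.IsProbabilityMeasure (D i)]
    (c σopt σ : Fin n → ℝ)
    (hint : ∀ i, MeasureTheory.Integrable (fun v => PandorasBox.relu (σopt i - v)) (D i))
    (hopt : ∀ i, PandorasBox.approxCost (D i) (σopt i) = c i)
    (πopt π : Equiv.Perm (Fin n))
    (hπopt : PandorasBox.IsSortedOrder σopt πopt)
    (hπ : PandorasBox.IsSortedOrder σ π) :
    PandorasBox.weitz D σ π c ≤
      PandorasBox.weitz D σopt πopt c +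
        ((∑ i, |PandorasBox.approxCost (D i) (σ i) - c i| : ℝ) : EReal) := by
  rcases Nat.eq_zero_or_pos n with rfl | hpos
  -- With no boxes the minimum over the empty set is `⊤`.
  · have htop : weitz D σopt πopt c = ⊤ := by
      simp [weitz, expectation, pandoraCost]
    rw [htop, EReal.top_add_coe]
    exact le_top
  have : NeZero n := ⟨hpos.ne'⟩
  set Q := weitzmanOpened σopt πopt
  have hQ : ∀ v, (Q v).Nonempty := weitzmanOpened_nonempty hπopt
  set g : (Fin n → ℝ) → ℝ := fun v => (pandoraCost c v (Q v)).toReal with hgdef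
  have hg : weitz D σopt πopt c = expectation (Measure.pi D) fun v => (g v : EReal) := by
    simp only [weitz, hgdef, coe_toReal_pandoraCost c _ (hQ _)]
    rfl
  by_cases hgi : Integrable g (Measure.pi D)
  · set f : Fin n → ℝ → ℝ := fun j x => c j - relu (σ j - x) with hfdef
    have hrelu : ∀ i, Integrable (fun x => relu (σ i - x)) (D i) := fun i =>
      integrable_relu_sub (hint i) (σ i)
    have hf : ∀ i, Integrable (f i) (D i) := fun i => (integrable_const _).sub (hrelu i)
    have hfint : ∀ i, ∫ x, f i x ∂D i = c i - approxCost (D i) (σ i) := fun i => by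
      simp only [hfdef]
      rw [integral_sub (integrable_const _) (hrelu i)]
      simp [approxCost]
    have hI1 := integrable_sum_weitzmanOpened D hπ hf
    have hI2 := integrable_sum_weitzmanOpened D hπopt hf
    have hle := expectation_mono (Measure.pi D) fun v =>
      pandoraCost_weitzmanOpened_le hπ c v (hQ v)
    refine hle.trans ?_
    have hub := expectation_coe_of_integrable (hgi.add (hI1.sub hI2))
    rw [integral_add' hgi (hI1.sub hI2), integral_sub' hI1 hI2] at hub
    refine hub.le.trans ?_
    rw [hg, expectation_coe_of_integrable hgi, ← EReal.coe_add,
      EReal.coe_le_coe_iff,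
      integral_sum_weitzmanOpened D hπ hf, integral_sum_weitzmanOpened D hπopt hf,
      ← Finset.sum_sub_distrib]
    refine add_le_add le_rfl (Finset.sum_le_sum fun i _ => ?_)
    rw [hfint, ← mul_sub, abs_sub_comm]
    refine (le_abs_self _).trans ?_
    rw [abs_mul]
    -- Two probabilities differ by at most `1`.
    refine mul_le_of_le_one_right (abs_nonneg _) (abs_sub_le_iff.2 ⟨?_, ?_⟩) <;>
    linarith [measureReal_nonneg (μ := Measure.pi D) (s := {v | i ∈ weitzmanOpened σ π v}),
      measureReal_nonneg (μ := Measure.pi D) (s := {v | i ∈ weitzmanOpened σopt πopt v}),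
      measureReal_le_one (μ := Measure.pi D) (s := {v | i ∈ weitzmanOpened σ π v}),
      measureReal_le_one (μ := Measure.pi D) (s := {v | i ∈ weitzmanOpened σopt πopt v})]
  · have hm : Measurable g := (measurable_pandoraCost c fun i =>
      measurableSet_mem_weitzmanOpened hπopt i).ereal_toReal
    have hlow : Integrable
        (fun v : Fin n → ℝ => -∑ i, (|σopt i| + relu (σopt i - v i) + |c i|)) (Measure.pi D) :=
      (integrable_finsetSum _ fun i _ => ((integrable_const _).add
        (integrable_comp_eval D (hint i))).add (integrable_const _)).neg
    rw [hg, expectation_coe_of_not_integrable hm.aestronglyMeasurable hlow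
      (fun v => neg_sum_le_toReal_pandoraCost c σopt v (hQ v)) hgi, EReal.top_add_coe]
    exact le_top
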